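/- All spaces are real Banach spaces. A bounded linear operator $G\colon X\to Y$ is a Daugavet center if $\|G+T\|=\|G\|+\|T\|$ for every bounded linear operator $T\colon X\to Y$ of rank one. A series $\sum_{n\in\Gamma}x_n$ over an arbitrary (possibly uncountable) set $\Gamma$ converges unconditionally to $x$ if for every $\varepsilon>0$ there is a finite $A\subset\Gamma$ such that $\|x-\sum_{n\in B}x_n\|<\varepsilon$ for every finite $B\subset\Gamma$ with $B\supset A$. A bounded operator is weakly compact if the image of the closed unit ball is relatively weakly compact. A space embeds into $E$ if it is linearly homeomorphic to a subspace of $E$. Let $G\colon X\to Y$ be a nonzero Daugavet center and let $E$ be a Banach space. (1) If there are a set $\Gamma$ and weakly compact operators $T_n\colon E\to E$ $(n\in\Gamma)$ such that for every $x\in E$ the series $\sum_{n\in\Gamma}T_nx$ converges unconditionally to $x$, then neither $X$ nor $Y$ embeds into $E$. (2) In particular, if $E$ has an unconditional basis, countable or uncountable, then neither $X$ nor $Y$ embeds into $E$. (An unconditional basis is a family $(e_n)_{n\in\Gamma}$ in $E$ with biorthogonal functionals $e_n^*\in E^*$ such that for every $x\in E$ the series $\sum_{n\in\Gamma}e_n^*(x)e_n$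 converges unconditionally to $x$.) (3) In particular, if $E$ is an unconditional sum of reflexive subspaces, that is, if there are closed reflexive subspaces $E_n\subset E$ $(n\in\Gamma)$ such that every $x\in E$ has a unique representation as an unconditionally convergent series $x=\sum_{n\in\Gamma}x_n$ with $x_n\in E_n$, then neither $X$ nor $Y$ embeds into $E$. -/

import Mathlib

/-- A continuous linear operator `G : X → Y` is a Daugavet center if `‖G + T‖ = ‖G‖ + ‖T‖`
for every continuous operator `T : X → Y` of rank one. -/
def IsDaugavetCenter {X Y : Type*} [NormedAddCommGroup X] [NormedSpace ℝ X]
    [NormedAddCommGroup Y] [NormedSpace ℝ Y] (G : X →L[ℝ] Y) : Prop :=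
  ∀ T : X →L[ℝ] Y, Module.finrank ℝ (LinearMap.range (T : X →ₗ[ℝ] Y)) = 1 →
    ‖G + T‖ = ‖G‖ + ‖T‖

/-- An operator is weakly compact if it maps the closed unit ball to a set whose closure in the
weak topology is compact in the weak topology. -/
def IsWeaklyCompactOperator {X Y : Type*} [NormedAddCommGroup X] [NormedSpace ℝ X]
    [NormedAddCommGroup Y] [NormedSpace ℝ Y] (T : X →L[ℝ] Y) : Prop :=
  IsCompact (closure (toWeakSpace ℝ Y '' (T '' Metric.closedBall (0 : X) 1)))

/-- The (possibly uncountable) series `∑ T n` converges pointwise unconditionally to `S`.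
`HasSum` is convergence along the net of finite subsets of the index set. -/
def IsPointwiseUnconditionalSum {Γ X Y : Type*} [NormedAddCommGroup X] [NormedSpace ℝ X]
    [NormedAddCommGroup Y] [NormedSpace ℝ Y] (T : Γ → X →L[ℝ] Y) (S : X →L[ℝ] Y) : Prop :=
  ∀ x : X, HasSum (fun n => T n x) (S x)

/-- `X` embeds into `E`: some continuous linear map `X → E` is a homeomorphism onto its image. -/
def EmbedsInto (X E : Type*) [NormedAddCommGroup X] [NormedSpace ℝ X]
    [NormedAddCommGroup E] [NormedSpace ℝ E] : Prop :=
  ∃ J : X →L[ℝ] E, Topology.IsEmbedding J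

/-- A normed space is reflexive if the canonical map to its bidual is onto. -/
def IsReflexiveNormedSpace (X : Type*) [NormedAddCommGroup X] [NormedSpace ℝ X] : Prop :=
  Function.Surjective (NormedSpace.inclusionInDoubleDual ℝ X)

/-- `E` is the unconditional sum of the closed subspaces `F n`: every `x` has a unique
representation as an unconditionally convergent series `∑ y n` with `y n ∈ F n`. -/
structure IsUnconditionalSumOfSubspaces {Γ E : Type*} [NormedAddCommGroup E] [NormedSpace ℝ E]
    (F : Γ → Submodule ℝ E) : Prop where
  isClosed : ∀ n, IsClosed (F n : Set E)
  existsUnique : ∀ x : E, ∃! y : (n : Γ) → F n, HasSum (fun n => (y n : E)) x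

/-! Let `J` embed `X` or `Y` into `E`, and put `H = J` or `H = J ∘ G` respectively. Hahn–Banach
extension along `J` gives uniformly bounded functionals `Φ k` on `E` with `Φ k (H x) = k (G x)` for
`k` in the dual ball of `Y`. Composing the decomposition of the identity with `H` makes `H` a
pointwise unconditional sum of weakly compact operators `S n`, which
`not_isPointwiseUnconditionalSum` excludes.

Let `p e` be the essential supremum of `Φ k e` over the dual ball, modulo sets that are nowhere
dense with respect to slices. `Φ` is chosen without any continuity in `k`, so an ordinary supremum
could be approached only at functionals that slices do not detect. Let `α` be the supremum of `p (∑
n ∈ A, S n x)` over finite `A` and `‖x‖ ≤ 1`, finite by uniform boundedness. For a nearly optimal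
`A`, the Daugavet inequality `le_sliceSup_add` for `-∑ n ∈ A, S n` gives `x` with `p (H x - ∑ n ∈ A,
S n x)` at least about `‖G‖ + α`. But this vector is nearly a finite partial sum over indices
outside `A`, so `p` of it is at most about `α`: a contradiction.

For the inequality, `S x₀` is replaced by an extreme point `c` of the weak closure of the image of
the ball, with `p c ≥ p (S x₀)`. Slices at `c` form a weak neighbourhood basis, so the slice
property of `G` can be iterated, with shrinking dual slices, to get points whose images under `S`
approach `c` on ever more functionals. Convex combinations approach `c` in norm and keep `k (G x)`
near `‖G‖` on a late dual slice. -/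

open Set Filter Topology

/-! ### Extreme points and slices of compact convex sets. -/

section CompactConvex

variable {V : Type*} [AddCommGroup V] [Module ℝ V] [TopologicalSpace V]
  [IsTopologicalAddGroup V] [ContinuousSMul ℝ V]

/-- The convex join of two compact sets is compact. -/
theorem IsCompact.convexJoin_real {s t : Set V} (hs : IsCompact s) (ht : IsCompact t) :
    IsCompact (convexJoin ℝ s t) := by
  have h : convexJoin ℝ s t =
      (fun p : ℝ × V × V => (1 - p.1) • p.2.1 + p.1 • p.2.2) '' (Icc (0 : ℝ) 1 ×ˢ s ×ˢ t) := by
    ext v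
    simp only [mem_convexJoin, segment_eq_image, mem_image, mem_prod, Prod.exists]
    constructor
    · rintro ⟨a, ha, b, hb, θ, hθ, rfl⟩
      exact ⟨θ, a, b, ⟨hθ, ha, hb⟩, rfl⟩
    · rintro ⟨θ, a, b, ⟨hθ, ha, hb⟩, rfl⟩
      exact ⟨a, ha, b, hb, θ, hθ, rfl⟩
  rw [h]
  exact (isCompact_Icc.prod (hs.prod ht)).image (by fun_prop)

/-- A finite number of closed half-spaces not containing an extreme point `c` of a compact convex
set `C` cut out of `C` parts that lie in one compact convex set that does not contain `c`. -/
theorem exists_compact_convex_superset_notMem {C : Set V} [T2Space V] (hC : IsCompact C)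
    (hconv : Convex ℝ C) {c : V} (hc : c ∈ C.extremePoints ℝ) (F : Finset (V →L[ℝ] ℝ)) {η : ℝ}
    (hη : 0 < η) :
    ∃ K ⊆ C, IsCompact K ∧ Convex ℝ K ∧ c ∉ K ∧ ∀ g ∈ F, ∀ w ∈ C, η ≤ g (w - c) → w ∈ K := by
  classical
  induction F using Finset.induction_on with
  | empty => exact ⟨∅, empty_subset _, isCompact_empty, convex_empty, by simp, by simp⟩
  | insert g F _ ih =>
    obtain ⟨K, hKC, hK, hKconv, hcK, hKF⟩ := ih
    set L : Set V := {w ∈ C | η + g c ≤ g w} with hLdef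
    have hL : IsCompact L := hC.inter_right (isClosed_le continuous_const g.continuous)
    have hLconv : Convex ℝ L :=
      hconv.inter (convex_halfSpace_ge g.toLinearMap.isLinear _)
    have hcL : c ∉ L := fun h => by linarith [h.2]
    have hmem : ∀ w ∈ C, η ≤ g (w - c) → w ∈ L := fun w hw h =>
      ⟨hw, by rw [map_sub] at h; linarith⟩
    rcases K.eq_empty_or_nonempty with rfl | hKne
    · refine ⟨L, sep_subset _ _, hL, hLconv, hcL, fun g' hg' w hw h => ?_⟩
      rcases Finset.mem_insert.1 hg' with rfl | hg'
      · exact hmem w hw h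
      · exact absurd (hKF g' hg' w hw h) (by simp)
    rcases L.eq_empty_or_nonempty with hL0 | hLne
    · refine ⟨K, hKC, hK, hKconv, hcK, fun g' hg' w hw h => ?_⟩
      rcases Finset.mem_insert.1 hg' with rfl | hg'
      · exact absurd (hmem w hw h) (by simp [hL0])
      · exact hKF g' hg' w hw h
    refine ⟨convexJoin ℝ K L, ?_, hK.convexJoin_real hL, hKconv.convexJoin hLconv, ?_, ?_⟩
    · intro w hw
      obtain ⟨a, ha, b, hb, hw⟩ := mem_convexJoin.1 hw
      exact hconv.segment_subset (hKC ha) hb.1 hw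
    · intro h
      obtain ⟨a, ha, b, hb, hw⟩ := mem_convexJoin.1 h
      -- An extreme point on a segment in `C` is one of its endpoints, but `K` and `L` both miss
      -- `c`.
      rcases (mem_extremePoints_iff_forall_segment.1 hc).2 a (hKC ha) b hb.1 hw with rfl | rfl
      · exact hcK ha
      · exact hcL hb
    · intro g' hg' w hw h
      rcases Finset.mem_insert.1 hg' with rfl | hg'
      · exact subset_convexJoin_right hKne (hmem w hw h)
      · exact subset_convexJoin_left hLne (hKF g' hg' w hw h)

/-- The slices containing an extreme point of a compact convex set form a neighbourhood basis
for the weak topology. -/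
theorem exists_slice_of_mem_extremePoints [T2Space V] [LocallyConvexSpace ℝ V] {C : Set V}
    (hC : IsCompact C) (hconv : Convex ℝ C) {c : V} (hc : c ∈ C.extremePoints ℝ)
    (F : Finset (V →L[ℝ] ℝ)) {η : ℝ} (hη : 0 < η) :
    ∃ (h : V →L[ℝ] ℝ) (t : ℝ), t < h c ∧ ∀ w ∈ C, t < h w → ∀ g ∈ F, |g (w - c)| < η := by
  classical
  -- Adding the negatives makes the one-sided exclusions two-sided; a functional separating `c` from
  -- `K` then defines the slice.
  obtain ⟨K, -, hK, hKconv, hcK, hKF⟩ :=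
    exists_compact_convex_superset_notMem hC hconv hc (F ∪ F.image fun g => -g) hη
  obtain ⟨f, u, hfu, hu⟩ := geometric_hahn_banach_closed_point hKconv hK.isClosed hcK
  refine ⟨f, u, hu, fun w hw hfw g hg => ?_⟩
  have hwK : w ∉ K := fun h => (hfu w h).not_gt hfw
  rw [abs_lt]
  constructor
  · by_contra! h
    refine hwK (hKF (-g) ?_ w hw ?_)
    · exact Finset.mem_union_right _ (Finset.mem_image_of_mem _ hg)
    · change η ≤ -(g (w - c))
      linarith
  · by_contra! h
    exact hwK (hKF g (Finset.mem_union_left _ hg) w hw h)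

/-- A continuous functional attains its maximum on a compact set at an extreme point. -/
theorem exists_mem_extremePoints_isMaxOn [T2Space V] [LocallyConvexSpace ℝ V] {C : Set V}
    (hC : IsCompact C) (hne : C.Nonempty) (l : V →L[ℝ] ℝ) :
    ∃ c ∈ C.extremePoints ℝ, ∀ w ∈ C, l w ≤ l c := by
  have h : IsExposed ℝ C {y ∈ C | ∀ z ∈ C, l z ≤ l y} := fun _ => ⟨l, rfl⟩
  obtain ⟨z, hzC, hz⟩ := hC.exists_isMaxOn hne l.continuous.continuousOn
  obtain ⟨y, hy⟩ := (h.isCompact hC).extremePoints_nonempty ⟨z, hzC, hz⟩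
  exact ⟨y, h.isExtreme.extremePoints_subset_extremePoints hy, hy.1.2⟩

end CompactConvex

/-! ### Weak approximation and norm closed convex hulls. -/

section WeakTopology

variable {E : Type*} [NormedAddCommGroup E] [NormedSpace ℝ E]

instance WeakSpace.instLocallyConvexSpace : LocallyConvexSpace ℝ (WeakSpace ℝ E) :=
  inferInstanceAs (LocallyConvexSpace ℝ (WeakBilin (topDualPairing ℝ E).flip))

/-- A norm continuous functional, regarded as a weakly continuous one. -/
noncomputable def StrongDual.onWeakSpace (g : StrongDual ℝ E) : WeakSpace ℝ E →L[ℝ] ℝ where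
  toLinearMap := (g : E →ₗ[ℝ] ℝ).comp ((toWeakSpace ℝ E).symm : WeakSpace ℝ E →ₗ[ℝ] E)
  cont := WeakBilin.eval_continuous (topDualPairing ℝ E).flip _

/-- A finite-dimensional subspace is `1/2`-normed by a finite number of functionals. -/
theorem exists_finset_norming (V : Finset E) :
    ∃ F : Finset (StrongDual ℝ E), (∀ g ∈ F, ‖g‖ ≤ 1) ∧
      ∀ w ∈ Submodule.span ℝ (V : Set E), w ≠ 0 → ∃ g ∈ F, ‖w‖ / 2 ≤ g w := by
  classical
  set W := Submodule.span ℝ (V : Set E)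
  have : FiniteDimensional ℝ W := FiniteDimensional.span_finset ℝ V
  have : ProperSpace W := FiniteDimensional.proper ℝ W
  choose nf hnf1 hnf using fun w : E => exists_dual_vector'' ℝ w
  -- Compactness of the unit sphere of `W` leaves finitely many norming functionals that together
  -- exceed `1 / 2` on it.
  obtain ⟨t, -, ht⟩ := (isCompact_sphere (0 : W) 1).elim_nhds_subcover
    (fun w => {v : W | 1 / 2 < nf (w : E) (v : E)}) (by
      intro w hw
      have hw1 : ‖(w : E)‖ = 1 := by simpa using hw
      refine (isOpen_lt continuous_const
        ((nf (w : E)).continuous.comp continuous_subtype_val)).mem_nhds ?_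
      have := hnf (w : E)
      simp only [mem_ofPred_eq, Function.comp_apply, this, hw1]
      norm_num)
  refine ⟨t.image fun w : W => nf (w : E), ?_, ?_⟩
  · intro g hg
    obtain ⟨w, -, rfl⟩ := Finset.mem_image.1 hg
    exact hnf1 _
  · intro w hw hw0
    have hpos : 0 < ‖w‖ := norm_pos_iff.2 hw0
    set v : W := ‖w‖⁻¹ • ⟨w, hw⟩ with hv
    have hvs : v ∈ Metric.sphere (0 : W) 1 := by
      simp only [mem_sphere_iff_norm, sub_zero, hv, norm_smul, norm_inv, norm_norm]
      exact inv_mul_cancel₀ hpos.ne'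
    obtain ⟨u, hu, huv⟩ := mem_iUnion₂.1 (ht hvs)
    refine ⟨nf u, Finset.mem_image_of_mem _ hu, ?_⟩
    have h2 : 1 / 2 < ‖w‖⁻¹ * nf (u : E) w := by simpa [hv] using huv
    rw [lt_inv_mul_iff₀ hpos] at h2
    linarith

/-- If, in a process whose moves pick points of a weakly compact set, the points can always be
picked arbitrarily close to `c` in the weak topology, then the process can be run so that `c` is in
the norm closed convex hull of the picked points. -/
theorem exists_seq_mem_closure_convexHull {α : Type*} {C : Set E}
    (hC : IsCompact (toWeakSpace ℝ E '' C)) {c : E} {R : α → E → α → Prop}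
    (hR : ∀ (a : α) (F : Finset (StrongDual ℝ E)) (η : ℝ), 0 < η →
      ∃ e ∈ C, ∃ b, R a e b ∧ ∀ g ∈ F, |g (e - c)| < η) (a₀ : α) :
    ∃ (a : ℕ → α) (e : ℕ → E), a 0 = a₀ ∧ (∀ n, R (a n) (e n) (a (n + 1))) ∧
      c ∈ closure (convexHull ℝ (range e)) := by
  classical
  choose pick hpickC next hnext hpick using hR
  choose norming hnorming1 hnorming using fun V : Finset E => exists_finset_norming V
  have hpos (n : ℕ) : (0 : ℝ) < 1 / (n + 1) := Nat.one_div_pos_of_nat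
  -- a state consists of a position, the points chosen so far, and the functionals to be controlled
  let step : ℕ → α × Finset E × Finset (StrongDual ℝ E) →
      α × Finset E × Finset (StrongDual ℝ E) := fun n s =>
    let V := insert (pick s.1 s.2.2 (1 / (n + 1)) (hpos n)) s.2.1
    (next s.1 s.2.2 (1 / (n + 1)) (hpos n), V, s.2.2 ∪ norming V)
  let st : ℕ → α × Finset E × Finset (StrongDual ℝ E) := fun n =>
    Nat.rec (a₀, {c}, norming {c}) step n
  let e : ℕ → E := fun n => pick (st n).1 (st n).2.2 (1 / (n + 1)) (hpos n)
  have hVsucc (n : ℕ) : (st (n + 1)).2.1 = insert (e n) (st n).2.1 := rfl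
  have hFsucc (n : ℕ) : (st (n + 1)).2.2 = (st n).2.2 ∪ norming (st (n + 1)).2.1 := rfl
  have hVmono : Monotone fun n => (st n).2.1 :=
    monotone_nat_of_le_succ fun n => by rw [hVsucc]; exact Finset.subset_insert _ _
  have hFmono : Monotone fun n => (st n).2.2 :=
    monotone_nat_of_le_succ fun n => by rw [hFsucc]; exact Finset.subset_union_left
  have hFV (n : ℕ) : norming (st n).2.1 ⊆ (st n).2.2 := by
    cases n with
    | zero => exact Finset.Subset.refl _
    | succ n => rw [hFsucc]; exact Finset.subset_union_right
  have hcV (n : ℕ) : c ∈ (st n).2.1 := hVmono (Nat.zero_le n) (Finset.mem_singleton_self c)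
  have heV (n : ℕ) : e n ∈ (st (n + 1)).2.1 := by rw [hVsucc]; exact Finset.mem_insert_self _ _
  have hlim (n : ℕ) (g : StrongDual ℝ E) (hg : g ∈ (st n).2.2) :
      Tendsto (fun m => g (e m)) atTop (𝓝 (g c)) := by
    rw [tendsto_iff_dist_tendsto_zero]
    refine squeeze_zero' (Eventually.of_forall fun _ => dist_nonneg) ?_
      tendsto_one_div_add_atTop_nhds_zero_nat
    filter_upwards [eventually_ge_atTop n] with m hm
    rw [Real.dist_eq, ← map_sub]
    exact (hpick (st m).1 (st m).2.2 (1 / (m + 1)) (hpos m) g (hFmono hm hg)).le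
  refine ⟨fun n => (st n).1, e, rfl, fun n => hnext _ _ _ _, ?_⟩
  obtain ⟨d', -, hd⟩ := hC.exists_mapClusterPt_of_frequently (l := atTop)
    (f := fun n => toWeakSpace ℝ E (e n)) (Eventually.frequently (Eventually.of_forall fun n =>
      mem_image_of_mem _ (hpickC _ _ _ _)))
  obtain ⟨d, rfl⟩ := (toWeakSpace ℝ E).surjective d'
  obtain ⟨U, hU, hdU⟩ := mapClusterPt_iff_ultrafilter.1 hd
  have hgd (n : ℕ) (g : StrongDual ℝ E) (hg : g ∈ (st n).2.2) : g d = g c := by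
    have h1 : Tendsto (fun m => g (e m)) U (𝓝 (g d)) :=
      (g.onWeakSpace.continuous.tendsto (toWeakSpace ℝ E d)).comp hdU
    exact tendsto_nhds_unique h1 ((hlim n g hg).mono_left hU)
  have hdcl : d ∈ closure (convexHull ℝ (range e)) := by
    have h1 : toWeakSpace ℝ E d ∈ closure (toWeakSpace ℝ E '' convexHull ℝ (range e)) := by
      refine mem_closure_of_tendsto hdU (Eventually.of_forall fun n => ?_)
      exact mem_image_of_mem _ (subset_convexHull ℝ _ (mem_range_self n))
    rw [← (convex_convexHull ℝ (range e)).toWeakSpace_closure ℝ] at h1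
    obtain ⟨d₁, hd₁, hdd⟩ := h1
    rwa [← (toWeakSpace ℝ E).injective hdd]
  -- `d - c` is a norm limit of vectors `w - c` in the spans, each half-normed by a controlled
  -- functional, and all controlled functionals vanish on `d - c`.
  suffices d = c by rwa [← this]
  have hspan : ∀ w ∈ convexHull ℝ (range e),
      ∃ n, w ∈ Submodule.span ℝ ((st n).2.1 : Set E) := by
    have hmono : Monotone fun n => Submodule.span ℝ ((st n).2.1 : Set E) :=
      fun i j hij => Submodule.span_mono (Finset.coe_subset.2 (hVmono hij))
    have hconv : Convex ℝ {w | ∃ n, w ∈ Submodule.span ℝ ((st n).2.1 : Set E)} := by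
      rintro x ⟨i, hi⟩ y ⟨j, hj⟩ a b - - -
      exact ⟨max i j, Submodule.add_mem _
        (Submodule.smul_mem _ _ (hmono (le_max_left i j) hi))
        (Submodule.smul_mem _ _ (hmono (le_max_right i j) hj))⟩
    refine convexHull_min ?_ hconv
    rintro _ ⟨n, rfl⟩
    exact ⟨n + 1, Submodule.subset_span (heV n)⟩
  rw [← sub_eq_zero, ← norm_le_zero_iff]
  refine le_of_forall_pos_le_add fun ε hε => ?_
  -- Since `‖w - c‖ / 2 ≤ ‖d - w‖` will follow, `‖d - c‖ ≤ 3 * ‖d - w‖`.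
  obtain ⟨w, hw, hdw⟩ := Metric.mem_closure_iff.1 hdcl (ε / 3) (by linarith)
  rw [dist_eq_norm] at hdw
  obtain ⟨n, hn⟩ := hspan w hw
  have hn' : w - c ∈ Submodule.span ℝ ((st n).2.1 : Set E) :=
    Submodule.sub_mem _ hn (Submodule.subset_span (hcV n))
  have htri : ‖d - c‖ ≤ ‖d - w‖ + ‖w - c‖ := norm_sub_le_norm_sub_add_norm_sub d w c
  by_cases h0 : w - c = 0
  · rw [h0, norm_zero] at htri
    linarith
  obtain ⟨g, hg, hgw⟩ := hnorming _ (w - c) hn' h0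
  have h1 : g (w - c) = -g (d - w) := by
    have := hgd n g (hFV n hg)
    simp only [map_sub, this]
    ring
  have h2 : |g (d - w)| ≤ ‖d - w‖ := by
    simpa using g.le_of_opNorm_le (hnorming1 _ g hg) (d - w)
  have := neg_le_abs (g (d - w))
  linarith

end WeakTopology

/-! ### Slices of the dual ball and the essential supremum. -/

section Slices

variable {Y : Type*} [NormedAddCommGroup Y] [NormedSpace ℝ Y]

/-- The slice of the dual unit ball on which evaluation at `y` exceeds `s`. -/
def dualSlice (y : Y) (s : ℝ) : Set (StrongDual ℝ Y) := {k | ‖k‖ ≤ 1 ∧ s < k y}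

theorem dualSlice_nonempty {y : Y} {s : ℝ} (hs : s < ‖y‖) : (dualSlice y s).Nonempty := by
  obtain ⟨g, hg1, hg⟩ := exists_dual_vector'' ℝ y
  exact ⟨g, hg1, by rw [hg]; exact hs⟩

/-- A set of functionals is slice-negligible if every slice of the dual unit ball contains a slice
disjoint from it. -/
def IsSliceNegligible (N : Set (StrongDual ℝ Y)) : Prop :=
  ∀ (y : Y) (s : ℝ), s < ‖y‖ → ∃ (y' : Y) (s' : ℝ), s' < ‖y'‖ ∧
    dualSlice y' s' ⊆ dualSlice y s ∧ Disjoint (dualSlice y' s') N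

theorem IsSliceNegligible.mono {N N' : Set (StrongDual ℝ Y)} (h : IsSliceNegligible N')
    (hN : ∀ k ∈ N, ‖k‖ ≤ 1 → k ∈ N') : IsSliceNegligible N := by
  intro y s hs
  obtain ⟨y', s', hs', hsub, hdisj⟩ := h y s hs
  exact ⟨y', s', hs', hsub, disjoint_left.2 fun k hk hkN =>
    disjoint_left.1 hdisj hk (hN k hkN hk.1)⟩

theorem IsSliceNegligible.union {N N' : Set (StrongDual ℝ Y)} (h : IsSliceNegligible N)
    (h' : IsSliceNegligible N') : IsSliceNegligible (N ∪ N') := by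
  intro y s hs
  obtain ⟨y₁, s₁, hs₁, hsub₁, hdisj₁⟩ := h y s hs
  obtain ⟨y₂, s₂, hs₂, hsub₂, hdisj₂⟩ := h' y₁ s₁ hs₁
  exact ⟨y₂, s₂, hs₂, hsub₂.trans hsub₁,
    disjoint_union_right.2 ⟨hdisj₁.mono_left hsub₂, hdisj₂⟩⟩

theorem isSliceNegligible_empty : IsSliceNegligible (∅ : Set (StrongDual ℝ Y)) :=
  fun y s hs => ⟨y, s, hs, Subset.rfl, disjoint_empty _⟩

theorem not_isSliceNegligible_of_closedBall_subset {N : Set (StrongDual ℝ Y)}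
    (h : ∀ k, ‖k‖ ≤ 1 → k ∈ N) : ¬ IsSliceNegligible N := by
  intro hN
  -- The slice given by `0` and `-1` is the whole dual ball.
  obtain ⟨y, s, hs, -, hdisj⟩ := hN 0 (-1) (by simp)
  obtain ⟨k, hk⟩ := dualSlice_nonempty hs
  exact disjoint_left.1 hdisj hk (h k hk.1)

/-- The essential supremum of a function on the dual unit ball, modulo slice-negligible sets. -/
noncomputable def sliceSup (φ : StrongDual ℝ Y → ℝ) : ℝ :=
  sInf {t | IsSliceNegligible {k | t < φ k}}

variable {φ ψ : StrongDual ℝ Y → ℝ} {B B' t : ℝ}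

/-- Boundedness on the ball makes the infimum in `sliceSup` genuine rather than the default value
`0`. -/
theorem bddBelow_sliceSup (hφ : ∀ k, ‖k‖ ≤ 1 → |φ k| ≤ B) :
    BddBelow {t | IsSliceNegligible {k | t < φ k}} := by
  refine ⟨-B, fun t ht => ?_⟩
  by_contra! h
  exact not_isSliceNegligible_of_closedBall_subset
    (fun k hk => h.trans_le (abs_le.1 (hφ k hk)).1) ht

theorem isSliceNegligible_setOf_lt (hφ : ∀ k, ‖k‖ ≤ 1 → φ k ≤ B) :
    IsSliceNegligible {k | B < φ k} :=
  isSliceNegligible_empty.mono fun k hk hk1 => absurd (hφ k hk1) (not_le.2 hk)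

theorem sliceSup_le (hφ : ∀ k, ‖k‖ ≤ 1 → |φ k| ≤ B) (ht : IsSliceNegligible {k | t < φ k}) :
    sliceSup φ ≤ t :=
  csInf_le (bddBelow_sliceSup hφ) ht

theorem isSliceNegligible_of_sliceSup_lt (hφ : ∀ k, ‖k‖ ≤ 1 → |φ k| ≤ B)
    (ht : sliceSup φ < t) : IsSliceNegligible {k | t < φ k} := by
  obtain ⟨t', ht', htt'⟩ := exists_lt_of_csInf_lt
    ⟨B, isSliceNegligible_setOf_lt fun k hk => (abs_le.1 (hφ k hk)).2⟩ ht
  exact IsSliceNegligible.mono ht' fun k hk _ => htt'.trans hk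

theorem sliceSup_le_of_forall_le (hφ : ∀ k, ‖k‖ ≤ 1 → |φ k| ≤ B) : sliceSup φ ≤ B :=
  sliceSup_le hφ (isSliceNegligible_setOf_lt fun k hk => (abs_le.1 (hφ k hk)).2)

/-- Subadditivity comes from negligibility of the union of two negligible sets; with positive
homogeneity it allows Hahn–Banach to be applied to `e ↦ sliceSup (fun k => Φ k e)`. -/
theorem sliceSup_add_le (hφ : ∀ k, ‖k‖ ≤ 1 → |φ k| ≤ B) (hψ : ∀ k, ‖k‖ ≤ 1 → |ψ k| ≤ B') :
    sliceSup (fun k => φ k + ψ k) ≤ sliceSup φ + sliceSup ψ := by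
  refine le_of_forall_pos_le_add fun ε hε => ?_
  have h1 := isSliceNegligible_of_sliceSup_lt hφ (t := sliceSup φ + ε / 2) (by linarith)
  have h2 := isSliceNegligible_of_sliceSup_lt hψ (t := sliceSup ψ + ε / 2) (by linarith)
  refine sliceSup_le (B := B + B') (fun k hk => ?_) ((h1.union h2).mono fun k hk _ => ?_)
  · exact (abs_add_le _ _).trans (add_le_add (hφ k hk) (hψ k hk))
  · by_contra h
    simp only [mem_union, mem_ofPred_eq, not_or, not_lt] at h hk
    linarith

theorem sliceSup_const_mul_le (hφ : ∀ k, ‖k‖ ≤ 1 → |φ k| ≤ B) {c : ℝ} (hc : 0 < c) :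
    sliceSup (fun k => c * φ k) ≤ c * sliceSup φ := by
  refine le_of_forall_pos_le_add fun ε hε => ?_
  have h1 := isSliceNegligible_of_sliceSup_lt hφ (t := sliceSup φ + ε / c)
    (by linarith [div_pos hε hc])
  refine sliceSup_le (B := c * B) (fun k hk => ?_) (h1.mono fun k hk _ => ?_)
  · rw [abs_mul, abs_of_pos hc]
    exact mul_le_mul_of_nonneg_left (hφ k hk) hc.le
  · simp only [mem_ofPred_eq] at hk ⊢
    refine lt_of_mul_lt_mul_left ?_ hc.le
    rwa [mul_add, mul_div_cancel₀ _ hc.ne']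

theorem sliceSup_const_mul (hφ : ∀ k, ‖k‖ ≤ 1 → |φ k| ≤ B) {c : ℝ} (hc : 0 < c) :
    sliceSup (fun k => c * φ k) = c * sliceSup φ := by
  refine le_antisymm (sliceSup_const_mul_le hφ hc) ?_
  have h := sliceSup_const_mul_le (φ := fun k => c * φ k) (B := c * B) (fun k hk => ?_)
    (inv_pos.2 hc)
  · simp only [inv_mul_cancel_left₀ hc.ne'] at h
    rwa [le_inv_mul_iff₀ hc] at h
  · rw [abs_mul, abs_of_pos hc]
    exact mul_le_mul_of_nonneg_left (hφ k hk) hc.le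

end Slices

/-! ### Slice characterisation of Daugavet centers. -/

section DaugavetCenter

variable {X Y : Type*} [NormedAddCommGroup X] [NormedSpace ℝ X]
  [NormedAddCommGroup Y] [NormedSpace ℝ Y] {G : X →L[ℝ] Y}

theorem ContinuousLinearMap.finrank_range_smulRight {f : StrongDual ℝ X} (hf : f ≠ 0) {y : Y}
    (hy : y ≠ 0) :
    Module.finrank ℝ (LinearMap.range ((f.smulRight y : X →L[ℝ] Y) : X →ₗ[ℝ] Y)) = 1 := by
  have h : LinearMap.range ((f.smulRight y : X →L[ℝ] Y) : X →ₗ[ℝ] Y) = Submodule.span ℝ {y} := by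
    obtain ⟨x, hx⟩ : ∃ x, f x ≠ 0 := by
      by_contra! h
      exact hf (ContinuousLinearMap.ext h)
    ext v
    rw [LinearMap.mem_range, Submodule.mem_span_singleton]
    constructor
    · rintro ⟨x, rfl⟩
      exact ⟨f x, rfl⟩
    · rintro ⟨a, rfl⟩
      refine ⟨(a / f x) • x, ?_⟩
      simp [smul_smul, div_mul_cancel₀ _ hx]
  rw [h, finrank_span_singleton hy]

/-- The rank-one operator `x ↦ (f x / ‖f‖) • y` has norm `‖y‖`. A vector almost norming its sum with
`G` must have `f x / ‖f‖` close to `1`, up to sign. -/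
theorem IsDaugavetCenter.exists_mem_slice_of_ne_zero (hG : IsDaugavetCenter G)
    {f : StrongDual ℝ X} (hf : f ≠ 0) {t : ℝ} (ht : t < ‖f‖) {y : Y} (hy : y ≠ 0) {ε : ℝ}
    (hε : 0 < ε) : ∃ x, ‖x‖ ≤ 1 ∧ t < f x ∧ ‖G‖ + ‖y‖ - ε < ‖G x + y‖ := by
  have hfpos : 0 < ‖f‖ := norm_pos_iff.2 hf
  have hypos : 0 < ‖y‖ := norm_pos_iff.2 hy
  have hrank := hG (f.smulRight (‖f‖⁻¹ • y))
    (ContinuousLinearMap.finrank_range_smulRight hf (smul_ne_zero (inv_ne_zero hfpos.ne') hy))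
  have hnorm : ‖f.smulRight (‖f‖⁻¹ • y)‖ = ‖y‖ := by
    rw [ContinuousLinearMap.norm_smulRight_apply, norm_smul, norm_inv, norm_norm,
      mul_inv_cancel_left₀ hfpos.ne']
  rw [hnorm] at hrank
  -- One `ε / 2` pays for almost norming, the other for replacing `a • y` by `y`; the second entry
  -- forces `t / ‖f‖ < a`.
  set η := min (ε / 2) (‖y‖ * ((‖f‖ - t) / ‖f‖)) with hη
  have hηpos : 0 < η := lt_min (by linarith) (by have := sub_pos.2 ht; positivity)
  obtain ⟨x, hx1, hx⟩ := ContinuousLinearMap.exists_lt_apply_of_lt_opNorm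
    (G + f.smulRight (‖f‖⁻¹ • y)) (r := ‖G‖ + ‖y‖ - η) (by linarith)
  wlog hfx : 0 ≤ f x generalizing x
  · refine this (-x) (by rwa [norm_neg]) ?_ (by rw [map_neg]; linarith)
    rwa [map_neg, norm_neg]
  set a := f x * ‖f‖⁻¹ with ha
  have ha0 : 0 ≤ a := by positivity
  have hx' : ‖G‖ + ‖y‖ - η < ‖G x + a • y‖ := by
    simpa [ha, smul_smul] using hx
  have hGx : ‖G x‖ ≤ ‖G‖ := by
    simpa using (G.le_opNorm_of_le hx1.le)
  have hay : ‖a • y‖ = a * ‖y‖ := by rw [norm_smul, Real.norm_of_nonneg ha0]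
  have h1 : ‖y‖ - η < a * ‖y‖ := by
    have := norm_add_le (G x) (a • y)
    linarith
  have ha1 : a ≤ 1 := by
    rw [ha, ← div_eq_mul_inv, div_le_one hfpos]
    calc f x ≤ |f x| := le_abs_self _
      _ ≤ ‖f‖ := by simpa using (f.le_opNorm_of_le hx1.le)
  refine ⟨x, hx1.le, ?_, ?_⟩
  · have h2 : ‖y‖ * (1 - (‖f‖ - t) / ‖f‖) < ‖y‖ * a := by
      have := min_le_right (ε / 2) (‖y‖ * ((‖f‖ - t) / ‖f‖))
      linarith
    have h3 := lt_of_mul_lt_mul_left h2 hypos.le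
    have h4 : 1 - (‖f‖ - t) / ‖f‖ = t / ‖f‖ := by field_simp; ring
    rw [h4, ha, ← div_eq_mul_inv] at h3
    exact (div_lt_div_iff_of_pos_right hfpos).1 h3
  · have h2 : ‖G x + a • y‖ ≤ ‖G x + y‖ + ‖(1 - a) • y‖ := by
      have : G x + a • y = (G x + y) - (1 - a) • y := by module
      rw [this]
      exact norm_sub_le _ _
    rw [norm_smul, Real.norm_of_nonneg (by linarith)] at h2
    have := min_le_left (ε / 2) (‖y‖ * ((‖f‖ - t) / ‖f‖))
    linarith

/-- Every slice of the unit ball contains points whose image under a Daugavet center `G` has norm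
almost `‖G‖` and almost the direction of a given vector, in the sense of the triangle inequality. -/
theorem IsDaugavetCenter.exists_mem_slice (hG : IsDaugavetCenter G) (hG0 : G ≠ 0)
    (f : StrongDual ℝ X) {t : ℝ} (ht : t < ‖f‖) (y : Y) {ε : ℝ} (hε : 0 < ε) :
    ∃ x, ‖x‖ ≤ 1 ∧ t < f x ∧ ‖G‖ + ‖y‖ - ε < ‖G x + y‖ := by
  obtain ⟨x₀, hx₀⟩ : ∃ x, G x ≠ 0 := by
    by_contra! h
    exact hG0 (ContinuousLinearMap.ext h)
  obtain ⟨y', hy', hyy⟩ : ∃ y' : Y, y' ≠ 0 ∧ ∀ x, ‖G‖ + ‖y'‖ - ε < ‖G x + y'‖ →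
      ‖G‖ + ‖y‖ - ε < ‖G x + y‖ := by
    by_cases hy : y = 0
    · refine ⟨G x₀, hx₀, fun x hx => ?_⟩
      have := norm_add_le (G x) (G x₀)
      rw [hy, norm_zero, add_zero, add_zero]
      linarith
    · exact ⟨y, hy, fun _ h => h⟩
  -- If `f = 0`, then `t < 0` and the slice is the whole ball, so any nonzero functional serves.
  obtain ⟨f', t', hf', ht', hff⟩ : ∃ (f' : StrongDual ℝ X) (t' : ℝ), f' ≠ 0 ∧ t' < ‖f'‖ ∧
      ∀ x, t' < f' x → t < f x := by
    by_cases hf : f = 0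
    · have hx₀' : x₀ ≠ 0 := fun h => hx₀ (by rw [h, map_zero])
      obtain ⟨g, hg1, -⟩ := exists_dual_vector ℝ x₀ (norm_ne_zero_iff.2 hx₀')
      refine ⟨g, 0, fun h => ?_, by rw [hg1]; exact one_pos, fun x _ => ?_⟩
      · rw [h, norm_zero] at hg1
        exact zero_ne_one hg1
      · simpa [hf] using ht
    · exact ⟨f, t, hf, ht, fun _ h => h⟩
  obtain ⟨x, hx1, hx, hxy⟩ := hG.exists_mem_slice_of_ne_zero hf' ht' hy' hε
  exact ⟨x, hx1, hff x hx, hyy x hxy⟩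

/-- Given a slice of the unit ball of `X` and a slice of the dual unit ball of `Y`, there are a
point of the former and a subslice of the latter, on which its image is almost normed. -/
theorem IsDaugavetCenter.exists_subslice (hG : IsDaugavetCenter G) (hG0 : G ≠ 0)
    (f : StrongDual ℝ X) {t : ℝ} (ht : t < ‖f‖) {y : Y} {s : ℝ} (hs : s < ‖y‖) {ε : ℝ}
    (hε : 0 < ε) : ∃ x, ‖x‖ ≤ 1 ∧ t < f x ∧ ∃ (y' : Y) (s' : ℝ), s' < ‖y'‖ ∧
      dualSlice y' s' ⊆ dualSlice y s ∧ ∀ k ∈ dualSlice y' s', ‖G‖ - ε < k (G x) := by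
  set δ := min ε (‖y‖ - s)
  have hδ : 0 < δ := lt_min hε (sub_pos.2 hs)
  obtain ⟨x, hx1, hx, hxy⟩ := hG.exists_mem_slice hG0 f ht y hδ
  have hle (k : StrongDual ℝ Y) (hk : ‖k‖ ≤ 1) (v : Y) : k v ≤ ‖v‖ :=
    (le_abs_self _).trans (by simpa using k.le_of_opNorm_le hk v)
  have hGx : ‖G x‖ ≤ ‖G‖ := by simpa using G.le_opNorm_of_le hx1
  have hδ1 : δ ≤ ε := min_le_left _ _
  have hδ2 : δ ≤ ‖y‖ - s := min_le_right _ _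
  -- Since `k (G x) ≤ ‖G‖` and `k y ≤ ‖y‖`, a sum within `δ` of `‖G‖ + ‖y‖` puts each term within
  -- `δ` of its bound.
  refine ⟨x, hx1, hx, G x + y, ‖G‖ + ‖y‖ - δ, hxy, fun k hk => ⟨hk.1, ?_⟩, fun k hk => ?_⟩
  all_goals
    have h1 := hk.2
    rw [map_add] at h1
    have h2 := hle k hk.1 (G x)
    have h3 := hle k hk.1 y
    linarith

end DaugavetCenter

/-! ### Supporting functionals of sublinear functionals. -/

/-- A sublinear functional dominated by a multiple of the norm is supported at every point by a
continuous linear functional. -/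
theorem exists_strongDual_le_sublinear {E : Type*} [NormedAddCommGroup E] [NormedSpace ℝ E]
    {N : E → ℝ} {M : ℝ} (hsmul : ∀ c : ℝ, 0 < c → ∀ x, N (c • x) = c * N x)
    (hadd : ∀ x y, N (x + y) ≤ N x + N y) (hM : ∀ x, N x ≤ M * ‖x‖) (v : E) :
    ∃ g : StrongDual ℝ E, g v = N v ∧ ∀ x, g x ≤ N x := by
  have h0 : N 0 = 0 := by
    have := hsmul 2 two_pos 0
    rw [smul_zero] at this
    linarith
  obtain ⟨g, hgv, hg⟩ : ∃ g : E →ₗ[ℝ] ℝ, g v = N v ∧ ∀ x, g x ≤ N x := by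
    by_cases hv : v = 0
    · obtain ⟨g, -, hg⟩ := exists_extension_of_le_sublinear (⊥ : E →ₗ.[ℝ] ℝ) N hsmul hadd (by
        rintro ⟨x, hx⟩
        obtain rfl : x = 0 := (Submodule.mem_bot ℝ).1 hx
        rw [h0]
        exact (LinearPMap.map_zero _).le)
      exact ⟨g, by rw [hv, map_zero, h0], hg⟩
    · obtain ⟨g, hgf, hg⟩ := exists_extension_of_le_sublinear
        (LinearPMap.mkSpanSingleton (K := ℝ) v (N v) hv) N hsmul hadd (by
        rintro ⟨x, hx⟩
        obtain ⟨c, rfl⟩ := Submodule.mem_span_singleton.1 hx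
        rw [LinearPMap.mkSpanSingleton'_apply]
        rcases lt_trichotomy c 0 with hc | rfl | hc
        · have h1 := hsmul (-c) (neg_pos.2 hc) v
          have h2 := hadd (c • v) ((-c) • v)
          rw [← add_smul, add_neg_cancel, zero_smul, h0] at h2
          change c * N v ≤ N (c • v)
          linarith
        · simp [h0]
        · exact (hsmul c hc v).ge)
      refine ⟨g, ?_, hg⟩
      have := hgf ⟨v, Submodule.mem_span_singleton_self v⟩
      rw [this]
      exact LinearPMap.mkSpanSingleton'_apply_self _ _ _ _
  refine ⟨g.mkContinuous M fun x => ?_, hgv, hg⟩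
  rw [Real.norm_eq_abs, abs_le]
  constructor
  · have := (hg (-x)).trans (hM (-x))
    rw [map_neg, norm_neg] at this
    linarith
  · exact (hg x).trans (hM x)

/-! ### The Daugavet inequality for weakly compact operators. -/

section WeaklyCompactPerturbation

variable {X Y E : Type*} [NormedAddCommGroup X] [NormedSpace ℝ X]
  [NormedAddCommGroup Y] [NormedSpace ℝ Y] [NormedAddCommGroup E] [NormedSpace ℝ E]
  {G : X →L[ℝ] Y} {S : X →L[ℝ] E}

/-- If `S` is weakly compact, then every extreme point `c` of the weak closure of the image of the
unit ball can be approximated by values of `S` at points whose image under the Daugavet center `G`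
is almost normed by all functionals in some slice. -/
theorem IsDaugavetCenter.exists_norm_sub_lt_of_extremePoint (hG : IsDaugavetCenter G)
    (hG0 : G ≠ 0) (hS : IsWeaklyCompactOperator S) {c : E}
    (hc : toWeakSpace ℝ E c ∈
      (closure (toWeakSpace ℝ E '' (S '' Metric.closedBall (0 : X) 1))).extremePoints ℝ)
    {y : Y} {s : ℝ} (hs : s < ‖y‖) {ε : ℝ} (hε : 0 < ε) :
    ∃ x, ‖x‖ ≤ 1 ∧ ‖c - S x‖ < ε ∧ ∃ (y' : Y) (s' : ℝ), s' < ‖y'‖ ∧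
      dualSlice y' s' ⊆ dualSlice y s ∧ ∀ k ∈ dualSlice y' s', ‖G‖ - ε < k (G x) := by
  classical
  have hconv : Convex ℝ (toWeakSpace ℝ E '' (S '' Metric.closedBall (0 : X) 1)) :=
    ((convex_closedBall _ _).linear_image S.toLinearMap).linear_image (toWeakSpace ℝ E).toLinearMap
  let C : Set E :=
    toWeakSpace ℝ E ⁻¹' closure (toWeakSpace ℝ E '' (S '' Metric.closedBall (0 : X) 1))
  have hC : toWeakSpace ℝ E '' C =
      closure (toWeakSpace ℝ E '' (S '' Metric.closedBall (0 : X) 1)) :=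
    image_preimage_eq _ (toWeakSpace ℝ E).surjective
  -- A position is a nonempty dual slice; a move shrinks it so that the new point is almost normed
  -- on it.
  let R : {a : Y × ℝ // a.2 < ‖a.1‖} → E → {a : Y × ℝ // a.2 < ‖a.1‖} → Prop := fun a e b =>
    ∃ x, ‖x‖ ≤ 1 ∧ S x = e ∧ dualSlice b.1.1 b.1.2 ⊆ dualSlice a.1.1 a.1.2 ∧
      ∀ k ∈ dualSlice b.1.1 b.1.2, ‖G‖ - ε < k (G x)
  have hR : ∀ (a : {a : Y × ℝ // a.2 < ‖a.1‖}) (F : Finset (StrongDual ℝ E)) (η : ℝ), 0 < η →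
      ∃ e ∈ C, ∃ b, R a e b ∧ ∀ g ∈ F, |g (e - c)| < η := by
    rintro ⟨⟨y, s⟩, hs⟩ F η hη
    obtain ⟨h, t, htc, hslice⟩ := exists_slice_of_mem_extremePoints hS hconv.closure hc
      (F.image StrongDual.onWeakSpace) hη
    let f : StrongDual ℝ X := h.comp ((toWeakSpaceCLM ℝ E).comp S)
    have htf : t < ‖f‖ := by
      obtain ⟨_, hw, _, ⟨x, hx, rfl⟩, rfl⟩ :=
        mem_closure_iff.1 hc.1 _ (isOpen_lt continuous_const h.continuous) htc
      have hx1 : ‖x‖ ≤ 1 := by simpa using hx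
      calc t < f x := hw
        _ ≤ |f x| := le_abs_self _
        _ ≤ ‖f‖ := by simpa using f.le_opNorm_of_le hx1
    obtain ⟨x, hx1, hfx, y', s', hs', hsub, hk⟩ := hG.exists_subslice hG0 f htf hs hε
    have hxC : toWeakSpace ℝ E (S x) ∈
        closure (toWeakSpace ℝ E '' (S '' Metric.closedBall (0 : X) 1)) :=
      subset_closure (mem_image_of_mem _ (mem_image_of_mem _ (by simpa using hx1)))
    refine ⟨S x, hxC, ⟨(y', s'), hs'⟩, ⟨x, hx1, rfl, hsub, hk⟩, fun g hg => ?_⟩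
    exact hslice _ hxC hfx _ (Finset.mem_image_of_mem _ hg)
  obtain ⟨a, e, ha0, hae, hce⟩ :=
    exists_seq_mem_closure_convexHull (C := C) (by rw [hC]; exact hS) hR ⟨(y, s), hs⟩
  have hanti : Antitone fun n => dualSlice (a n).1.1 (a n).1.2 :=
    antitone_nat_of_succ_le fun n => by
      obtain ⟨x, -, -, h, -⟩ := hae n
      exact h
  -- The slices decrease, so the latest slice serves all points of a finite convex combination;
  -- hence `Q` is convex.
  let Q : Set X := {x | ‖x‖ ≤ 1 ∧ ∃ n, ∀ k ∈ dualSlice (a n).1.1 (a n).1.2, ‖G‖ - ε < k (G x)}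
  have hQ : Convex ℝ Q := by
    rintro x ⟨hx1, i, hi⟩ x' ⟨hx1', j, hj⟩ α β hα hβ hαβ
    refine ⟨?_, max i j, fun k hk => ?_⟩
    · have := (convex_closedBall (0 : X) 1) (x := x) (by simpa using hx1) (y := x')
        (by simpa using hx1') hα hβ hαβ
      simpa using this
    · have h1 : ‖G‖ - ε < k (G x) := hi k (hanti (le_max_left i j) hk)
      have h2 : ‖G‖ - ε < k (G x') := hj k (hanti (le_max_right i j) hk)
      have h3 := (convex_Ioi (‖G‖ - ε)) h1 h2 hα hβ hαβ
      simpa using h3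
  have hsub : convexHull ℝ (range e) ⊆ S '' Q := by
    refine convexHull_min ?_ (hQ.linear_image S.toLinearMap)
    rintro _ ⟨n, rfl⟩
    obtain ⟨x, hx1, hxe, -, hk⟩ := hae n
    exact ⟨x, ⟨hx1, n + 1, hk⟩, hxe⟩
  obtain ⟨w, hw, hcw⟩ := Metric.mem_closure_iff.1 hce ε hε
  obtain ⟨x, ⟨hx1, n, hn⟩, rfl⟩ := hsub hw
  refine ⟨x, hx1, by rwa [← dist_eq_norm], (a n).1.1, (a n).1.2, (a n).2, ?_, hn⟩
  have := hanti (Nat.zero_le n)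
  simpa only [ha0] using this

variable {H : X →L[ℝ] E} {Φ : StrongDual ℝ Y → StrongDual ℝ E} {M : ℝ}

theorem abs_apply_le_of_norm_le (hΦ : ∀ k, ‖k‖ ≤ 1 → ‖Φ k‖ ≤ M) (e : E) :
    ∀ k, ‖k‖ ≤ 1 → |Φ k e| ≤ M * ‖e‖ :=
  fun k hk => (Φ k).le_of_opNorm_le (hΦ k hk) e

/-- The Daugavet type inequality for weakly compact operators: `Φ` is a system of functionals that
transfers the action of the dual ball of `Y` on `G` to an operator `H : X → E`. -/
theorem IsDaugavetCenter.le_sliceSup_add (hG : IsDaugavetCenter G) (hG0 : G ≠ 0)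
    (hΦ : ∀ k, ‖k‖ ≤ 1 → ‖Φ k‖ ≤ M) (hH : ∀ k, ‖k‖ ≤ 1 → ∀ x, Φ k (H x) = k (G x))
    (hS : IsWeaklyCompactOperator S) {x₀ : X} (hx₀ : ‖x₀‖ ≤ 1) {ε : ℝ} (hε : 0 < ε) :
    ∃ x, ‖x‖ ≤ 1 ∧
      ‖G‖ + sliceSup (fun k => Φ k (S x₀)) - ε ≤ sliceSup (fun k => Φ k (H x + S x)) := by
  have hM : 0 ≤ M := (norm_nonneg _).trans (hΦ 0 (by simp))
  have hb := abs_apply_le_of_norm_le hΦ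
  obtain ⟨f, hfx₀, hf⟩ := exists_strongDual_le_sublinear
    (N := fun e => sliceSup fun k => Φ k e) (M := M)
    (fun c hc e => by simpa using sliceSup_const_mul (hb e) hc)
    (fun e e' => by simpa using sliceSup_add_le (hb e) (hb e'))
    (fun e => sliceSup_le_of_forall_le (hb e)) (S x₀)
  have hx₀C : toWeakSpace ℝ E (S x₀) ∈
      closure (toWeakSpace ℝ E '' (S '' Metric.closedBall (0 : X) 1)) :=
    subset_closure (mem_image_of_mem _ (mem_image_of_mem _ (by simpa using hx₀)))
  obtain ⟨c', hc', hmax⟩ := exists_mem_extremePoints_isMaxOn hS ⟨_, hx₀C⟩ f.onWeakSpace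
  obtain ⟨c, rfl⟩ := (toWeakSpace ℝ E).surjective c'
  have hτ : sliceSup (fun k => Φ k (S x₀)) ≤ sliceSup fun k => Φ k c := by
    rw [← hfx₀]
    exact (hmax _ hx₀C).trans (hf c)
  set τ := sliceSup fun k => Φ k (S x₀)
  -- One `δ` is lost in `Φ k c`, one in `k (G x)`, and `M * δ` in `Φ k (c - S x)`; the third `δ` is
  -- slack.
  set δ := ε / (M + 3) with hδdef
  have hδ : 0 < δ := by positivity
  have hδε : (M + 3) * δ = ε := mul_div_cancel₀ _ (by positivity)
  have hnn : ¬ IsSliceNegligible {k | τ - δ < Φ k c} := fun h => by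
    linarith [sliceSup_le (hb c) h]
  simp only [IsSliceNegligible, not_forall, not_exists, not_and] at hnn
  -- Every subslice of this slice meets the set where `Φ k c` exceeds `τ - δ`.
  obtain ⟨y, s, hs, hthick⟩ := hnn
  obtain ⟨x, hx1, hcx, y', s', hs', hsub, hk⟩ :=
    hG.exists_norm_sub_lt_of_extremePoint hG0 hS hc' hs hδ
  refine ⟨x, hx1, ?_⟩
  by_contra! hlt
  obtain ⟨y'', s'', hs'', hsub', hdisj⟩ :=
    isSliceNegligible_of_sliceSup_lt (hb (H x + S x)) hlt y' s' hs'
  obtain ⟨k, hk'', hkV⟩ := not_disjoint_iff.1 (hthick y'' s'' hs'' (hsub'.trans hsub))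
  refine disjoint_left.1 hdisj hk'' ?_
  have h1 := hk k (hsub' hk'')
  have h2 : Φ k (c - S x) ≤ M * δ :=
    (le_abs_self _).trans ((hb (c - S x) k hk''.1).trans
      (mul_le_mul_of_nonneg_left hcx.le hM))
  have h3 : τ - δ < Φ k c := hkV
  rw [map_sub] at h2
  change ‖G‖ + τ - ε < Φ k (H x + S x)
  rw [map_add, hH k hk''.1]
  linarith

end WeaklyCompactPerturbation

/-! ### Partial sums of unconditional series. -/

theorem HasSum.exists_norm_sub_sum_lt {Γ E : Type*} [NormedAddCommGroup E] {f : Γ → E} {a : E}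
    (hf : HasSum f a) {ε : ℝ} (hε : 0 < ε) :
    ∃ A₀ : Finset Γ, ∀ A, A₀ ⊆ A → ‖a - ∑ n ∈ A, f n‖ < ε := by
  classical
  rw [HasSum, SummationFilter.unconditional_filter, Metric.tendsto_atTop] at hf
  obtain ⟨A₀, hA₀⟩ := hf ε hε
  exact ⟨A₀, fun A hA => by rw [← dist_eq_norm, dist_comm]; exact hA₀ A hA⟩

/-- The finite partial sums of an unconditionally convergent series are bounded. -/
theorem HasSum.exists_norm_sum_le {Γ E : Type*} [NormedAddCommGroup E] {f : Γ → E} {a : E}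
    (hf : HasSum f a) : ∃ C, ∀ A : Finset Γ, ‖∑ n ∈ A, f n‖ ≤ C := by
  classical
  obtain ⟨A₀, hA₀⟩ := hf.exists_norm_sub_sum_lt one_pos
  refine ⟨1 + ‖a‖ + ∑ n ∈ A₀, ‖f n‖, fun A => ?_⟩
  have h1 := hA₀ (A ∪ A₀) Finset.subset_union_right
  have h2 : ∑ n ∈ A, f n = a - (a - ∑ n ∈ A ∪ A₀, f n) - ∑ n ∈ A₀ \ A, f n := by
    rw [Finset.union_comm, ← Finset.sdiff_union_self_eq_union,
      Finset.sum_union Finset.sdiff_disjoint]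
    abel
  have h3 : ‖∑ n ∈ A₀ \ A, f n‖ ≤ ∑ n ∈ A₀, ‖f n‖ :=
    (norm_sum_le _ _).trans
      (Finset.sum_le_sum_of_subset_of_nonneg Finset.sdiff_subset fun _ _ _ => norm_nonneg _)
  have h4 := norm_sub_le (a - (a - ∑ n ∈ A ∪ A₀, f n)) (∑ n ∈ A₀ \ A, f n)
  have h5 := norm_sub_le a (a - ∑ n ∈ A ∪ A₀, f n)
  rw [h2]
  linarith

/-! ### Stability of weakly compact operators. -/

section WeaklyCompact

variable {X Y Z : Type*} [NormedAddCommGroup X] [NormedSpace ℝ X]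
  [NormedAddCommGroup Y] [NormedSpace ℝ Y] [NormedAddCommGroup Z] [NormedSpace ℝ Z]

theorem isWeaklyCompactOperator_of_forall_mem {T : X →L[ℝ] Y} {K : Set (WeakSpace ℝ Y)}
    (hK : IsCompact K) (h : ∀ x, ‖x‖ ≤ 1 → toWeakSpace ℝ Y (T x) ∈ K) :
    IsWeaklyCompactOperator T := by
  refine hK.closure_of_subset ?_
  rintro _ ⟨_, ⟨x, hx, rfl⟩, rfl⟩
  exact h x (by simpa using hx)

theorem IsWeaklyCompactOperator.mem_closure {T : X →L[ℝ] Y} {x : X} (hx : ‖x‖ ≤ 1) :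
    toWeakSpace ℝ Y (T x) ∈ closure (toWeakSpace ℝ Y '' (T '' Metric.closedBall (0 : X) 1)) :=
  subset_closure (mem_image_of_mem _ (mem_image_of_mem _ (by simpa using hx)))

theorem IsWeaklyCompactOperator.add {T S : X →L[ℝ] Y} (hT : IsWeaklyCompactOperator T)
    (hS : IsWeaklyCompactOperator S) : IsWeaklyCompactOperator (T + S) :=
  isWeaklyCompactOperator_of_forall_mem (IsCompact.add hT hS) fun _ hx =>
    Set.add_mem_add (mem_closure hx) (mem_closure hx)

theorem IsWeaklyCompactOperator.neg {T : X →L[ℝ] Y} (hT : IsWeaklyCompactOperator T) :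
    IsWeaklyCompactOperator (-T) :=
  isWeaklyCompactOperator_of_forall_mem (IsCompact.neg hT) fun x hx => by
    rw [Set.mem_neg]
    change - -toWeakSpace ℝ Y (T x) ∈ _
    rw [neg_neg]
    exact mem_closure hx

theorem isWeaklyCompactOperator_zero : IsWeaklyCompactOperator (0 : X →L[ℝ] Y) :=
  isWeaklyCompactOperator_of_forall_mem (isCompact_singleton (x := 0)) fun _ _ => rfl

theorem IsWeaklyCompactOperator.sum {Γ : Type*} {T : Γ → X →L[ℝ] Y}
    (hT : ∀ n, IsWeaklyCompactOperator (T n)) (A : Finset Γ) :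
    IsWeaklyCompactOperator (∑ n ∈ A, T n) :=
  Finset.sum_induction _ _ (fun _ _ => IsWeaklyCompactOperator.add) isWeaklyCompactOperator_zero
    fun n _ => hT n

theorem IsWeaklyCompactOperator.comp_right {T : Y →L[ℝ] Z} (hT : IsWeaklyCompactOperator T)
    (J : X →L[ℝ] Y) : IsWeaklyCompactOperator (T.comp J) := by
  -- The radius `‖J‖ + 1` stays invertible when `J = 0`.
  have hr : 0 < ‖J‖ + 1 := by positivity
  refine isWeaklyCompactOperator_of_forall_mem (IsCompact.smul (‖J‖ + 1) hT) fun x hx =>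
    ⟨toWeakSpace ℝ Z (T ((‖J‖ + 1)⁻¹ • J x)), mem_closure ?_, ?_⟩
  · rw [norm_smul, norm_inv, Real.norm_of_nonneg hr.le, inv_mul_le_iff₀ hr]
    have : ‖J x‖ ≤ ‖J‖ := by simpa using J.le_opNorm_of_le hx
    linarith
  · simp only [map_smul, smul_inv_smul₀ hr.ne', ContinuousLinearMap.comp_apply]

theorem isWeaklyCompactOperator_smulRight (f : StrongDual ℝ X) (y : Y) :
    IsWeaklyCompactOperator (f.smulRight y : X →L[ℝ] Y) := by
  refine isWeaklyCompactOperator_of_forall_mem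
    ((isCompact_Icc (a := -‖f‖) (b := ‖f‖)).image
      (f := fun r : ℝ => r • toWeakSpace ℝ Y y) (by fun_prop)) fun x hx => ⟨f x, ?_, ?_⟩
  · rw [mem_Icc, ← abs_le]
    simpa using f.le_opNorm_of_le hx
  · simp

/-- Bounded sets in a reflexive space are relatively weakly compact. -/
theorem IsReflexiveNormedSpace.isCompact_closure_closedBall (hX : IsReflexiveNormedSpace X)
    (r : ℝ) : IsCompact (closure (toWeakSpace ℝ X '' Metric.closedBall (0 : X) r)) := by
  refine NormedSpace.isCompact_closure_of_isBounded ℝ X _ ?_ fun w _ => ?_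
  · rw [preimage_image_eq _ (toWeakSpace ℝ X).injective]
    exact Metric.isBounded_closedBall
  · obtain ⟨x, hx⟩ := hX (WeakDual.toStrongDual w)
    exact ⟨toWeakSpace ℝ X x, congrArg StrongDual.toWeakDual hx⟩

/-- An operator that factors through a reflexive space is weakly compact. -/
theorem IsReflexiveNormedSpace.isWeaklyCompactOperator_comp (hY : IsReflexiveNormedSpace Y)
    (T : Y →L[ℝ] Z) (P : X →L[ℝ] Y) : IsWeaklyCompactOperator (T.comp P) := by
  refine isWeaklyCompactOperator_of_forall_mem
    ((hY.isCompact_closure_closedBall ‖P‖).image (WeakSpace.map T).continuous) fun x hx => ?_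
  refine ⟨toWeakSpace ℝ Y (P x), subset_closure (mem_image_of_mem _ ?_), rfl⟩
  simpa using P.le_opNorm_of_le hx

end WeaklyCompact

/-! ### Extension of functionals along embeddings. -/

section Embedding

variable {Z E : Type*} [NormedAddCommGroup Z] [NormedSpace ℝ Z]
  [NormedAddCommGroup E] [NormedSpace ℝ E]

theorem ContinuousLinearMap.exists_norm_le_of_isEmbedding {J : Z →L[ℝ] E}
    (hJ : Topology.IsEmbedding J) : ∃ c, 0 ≤ c ∧ ∀ z, ‖z‖ ≤ c * ‖J z‖ := by
  have h : Metric.ball (0 : Z) 1 ∈ comap J (𝓝 0) := by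
    rw [← map_zero J, ← hJ.nhds_eq_comap]
    exact Metric.ball_mem_nhds _ one_pos
  obtain ⟨U, hU, hUJ⟩ := h
  obtain ⟨δ, hδ, hδU⟩ := Metric.mem_nhds_iff.1 hU
  have hsmall (z : Z) (hz : ‖J z‖ < δ) : ‖z‖ < 1 := by
    have : z ∈ Metric.ball (0 : Z) 1 := hUJ (hδU (by simpa using hz))
    simpa using this
  refine ⟨2 / δ, by positivity, fun z => ?_⟩
  by_cases hz : J z = 0
  · have : z = 0 := hJ.injective (by rw [hz, map_zero])
    simp [this]
  · have hpos : 0 < ‖J z‖ := norm_pos_iff.2 hz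
    have hr : 0 < δ / (2 * ‖J z‖) := by positivity
    have h1 := hsmall ((δ / (2 * ‖J z‖)) • z) (by
      rw [map_smul, norm_smul, Real.norm_of_nonneg hr.le]
      have : δ / (2 * ‖J z‖) * ‖J z‖ = δ / 2 := by field_simp
      linarith)
    rw [norm_smul, Real.norm_of_nonneg hr.le, div_mul_eq_mul_div, div_lt_one (by positivity)] at h1
    rw [div_mul_eq_mul_div, le_div_iff₀ hδ]
    linarith

/-- Functionals extend along an embedding, with control of the norm. -/
theorem ContinuousLinearMap.exists_extension_of_isEmbedding {J : Z →L[ℝ] E}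
    (hJ : Topology.IsEmbedding J) : ∃ c, 0 ≤ c ∧ ∀ φ : StrongDual ℝ Z, ∃ ψ : StrongDual ℝ E,
      (∀ z, ψ (J z) = φ z) ∧ ‖ψ‖ ≤ c * ‖φ‖ := by
  obtain ⟨c, hc, hcJ⟩ := exists_norm_le_of_isEmbedding hJ
  refine ⟨c, hc, fun φ => ?_⟩
  let e : Z ≃ₗ[ℝ] LinearMap.range (J : Z →ₗ[ℝ] E) :=
    LinearEquiv.ofInjective (J : Z →ₗ[ℝ] E) hJ.injective
  let ψ₀ : StrongDual ℝ (LinearMap.range (J : Z →ₗ[ℝ] E)) :=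
    ((φ : Z →ₗ[ℝ] ℝ).comp (e.symm : _ →ₗ[ℝ] Z)).mkContinuous (c * ‖φ‖) fun w => by
      obtain ⟨z, rfl⟩ := e.surjective w
      have h1 : ‖φ z‖ ≤ ‖φ‖ * ‖z‖ := φ.le_opNorm z
      have h2 : ‖e z‖ = ‖J z‖ := rfl
      have h3 := mul_le_mul_of_nonneg_left (hcJ z) (norm_nonneg φ)
      simp only [LinearMap.comp_apply, LinearEquiv.coe_coe, LinearEquiv.symm_apply_apply,
        ContinuousLinearMap.coe_coe, h2]
      linarith
  obtain ⟨ψ, hψ, hψn⟩ := exists_extension_norm_eq _ ψ₀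
  refine ⟨ψ, fun z => ?_, ?_⟩
  · have h1 := hψ (e z)
    have h2 : ψ₀ (e z) = φ z := by
      change φ (e.symm (e z)) = φ z
      rw [e.symm_apply_apply]
    rw [h2] at h1
    exact h1
  · rw [hψn]
    exact LinearMap.mkContinuous_norm_le _ (by positivity) _

end Embedding

/-! ### The contradiction for unconditional sums. -/

section UnconditionalSums

variable {X Y E Γ : Type*} [NormedAddCommGroup X] [NormedSpace ℝ X] [CompleteSpace X]
  [NormedAddCommGroup Y] [NormedSpace ℝ Y] [NormedAddCommGroup E] [NormedSpace ℝ E]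
  {G : X →L[ℝ] Y}

/-- An operator on which the dual ball of `Y` acts as on a nonzero Daugavet center `G : X → Y` is
not a pointwise unconditional sum of weakly compact operators. -/
theorem IsDaugavetCenter.not_isPointwiseUnconditionalSum (hG : IsDaugavetCenter G) (hG0 : G ≠ 0)
    {H : X →L[ℝ] E} {Φ : StrongDual ℝ Y → StrongDual ℝ E} {M : ℝ}
    (hΦ : ∀ k, ‖k‖ ≤ 1 → ‖Φ k‖ ≤ M) (hH : ∀ k, ‖k‖ ≤ 1 → ∀ x, Φ k (H x) = k (G x))
    {S : Γ → X →L[ℝ] E} (hS : ∀ n, IsWeaklyCompactOperator (S n)) :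
    ¬ IsPointwiseUnconditionalSum S H := by
  classical
  intro hsum
  have hM : 0 ≤ M := (norm_nonneg _).trans (hΦ 0 (by simp))
  have hb := abs_apply_le_of_norm_le hΦ
  have hg : 0 < ‖G‖ := norm_pos_iff.2 hG0
  obtain ⟨C, hC⟩ := banach_steinhaus (g := fun A : Finset Γ => ∑ n ∈ A, S n) fun x => by
    obtain ⟨C, hC⟩ := (hsum x).exists_norm_sum_le
    exact ⟨C, fun A => by simpa [sum_apply] using hC A⟩
  let V : Set ℝ := {r | ∃ (A : Finset Γ) (x : X), ‖x‖ ≤ 1 ∧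
    r = sliceSup fun k => Φ k ((∑ n ∈ A, S n) x)}
  have hVne : V.Nonempty := ⟨_, ∅, 0, by simp, rfl⟩
  have hVb : BddAbove V := by
    refine ⟨M * C, ?_⟩
    rintro _ ⟨A, x, hx, rfl⟩
    refine (sliceSup_le_of_forall_le (hb _)).trans (mul_le_mul_of_nonneg_left ?_ hM)
    exact (by simpa using (∑ n ∈ A, S n).le_opNorm_of_le hx : _ ≤ ‖∑ n ∈ A, S n‖).trans (hC A)
  obtain ⟨_, ⟨A, x₀, hx₀, rfl⟩, hα⟩ :=
    exists_lt_of_lt_csSup hVne (show sSup V - ‖G‖ / 4 < sSup V by linarith)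
  -- The signs of the operator and of `-x₀` cancel, so the nearly optimal value is kept.
  obtain ⟨x, hx, hle⟩ := hG.le_sliceSup_add hG0 hΦ hH (IsWeaklyCompactOperator.sum hS A).neg
    (x₀ := -x₀) (by rwa [norm_neg]) (show 0 < ‖G‖ / 4 by linarith)
  have hneg : (-∑ n ∈ A, S n) (-x₀) = (∑ n ∈ A, S n) x₀ := by
    rw [neg_apply, map_neg, neg_neg]
  rw [hneg] at hle
  obtain ⟨B₀, hB₀⟩ := (hsum x).exists_norm_sub_sum_lt
    (show 0 < ‖G‖ / (4 * (M + 1)) by positivity)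
  have hB := hB₀ (B₀ ∪ A) Finset.subset_union_left
  -- Removing `A` from the larger index set leaves another finite partial sum, again bounded by
  -- `sSup V`, plus a small tail.
  have hdec : H x + (-∑ n ∈ A, S n) x =
      (∑ n ∈ B₀ \ A, S n) x + (H x - ∑ n ∈ B₀ ∪ A, S n x) := by
    rw [← Finset.sdiff_union_self_eq_union, Finset.sum_union Finset.sdiff_disjoint]
    simp only [neg_apply, sum_apply]
    abel
  have h1 : sliceSup (fun k => Φ k (H x + (-∑ n ∈ A, S n) x)) ≤
      sliceSup (fun k => Φ k ((∑ n ∈ B₀ \ A, S n) x)) +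
        sliceSup fun k => Φ k (H x - ∑ n ∈ B₀ ∪ A, S n x) := by
    rw [hdec]
    simpa only [map_add] using sliceSup_add_le (hb ((∑ n ∈ B₀ \ A, S n) x))
      (hb (H x - ∑ n ∈ B₀ ∪ A, S n x))
  have h2 : sliceSup (fun k => Φ k ((∑ n ∈ B₀ \ A, S n) x)) ≤ sSup V :=
    le_csSup hVb ⟨_, x, hx, rfl⟩
  have h3 : sliceSup (fun k => Φ k (H x - ∑ n ∈ B₀ ∪ A, S n x)) ≤ ‖G‖ / 4 := by
    refine (sliceSup_le_of_forall_le (hb _)).trans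
      ((mul_le_mul_of_nonneg_left hB.le hM).trans ?_)
    rw [mul_div_assoc', div_le_div_iff₀ (by positivity) (by norm_num)]
    nlinarith
  linarith

/-- For `X`, `Φ k` extends `k ∘ G` along `J`; for `Y`, it extends `k` itself and `H` is `J ∘ G`. -/
theorem IsDaugavetCenter.not_embedsInto (hG : IsDaugavetCenter G) (hG0 : G ≠ 0)
    {T : Γ → E →L[ℝ] E} (hT : ∀ n, IsWeaklyCompactOperator (T n))
    (hsum : IsPointwiseUnconditionalSum T (ContinuousLinearMap.id ℝ E)) :
    ¬ EmbedsInto X E ∧ ¬ EmbedsInto Y E := by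
  constructor
  · rintro ⟨J, hJ⟩
    obtain ⟨c, hc, hext⟩ := ContinuousLinearMap.exists_extension_of_isEmbedding hJ
    choose ext hext hnorm using hext
    refine hG.not_isPointwiseUnconditionalSum hG0 (H := J) (Φ := fun k => ext (k.comp G))
      (M := c * ‖G‖) (fun k hk => (hnorm _).trans (mul_le_mul_of_nonneg_left ?_ hc))
      (fun k _ x => hext _ x) (fun n => (hT n).comp_right J) fun x => hsum (J x)
    calc ‖k.comp G‖ ≤ ‖k‖ * ‖G‖ := k.opNorm_comp_le G
      _ ≤ 1 * ‖G‖ := mul_le_mul_of_nonneg_right hk (norm_nonneg _)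
      _ = ‖G‖ := one_mul _
  · rintro ⟨J, hJ⟩
    obtain ⟨c, hc, hext⟩ := ContinuousLinearMap.exists_extension_of_isEmbedding hJ
    choose ext hext hnorm using hext
    refine hG.not_isPointwiseUnconditionalSum hG0 (H := J.comp G) (Φ := ext)
      (M := c) (fun k hk => (hnorm _).trans (mul_le_of_le_one_right hc hk))
      (fun k _ x => hext _ (G x)) (fun n => (hT n).comp_right (J.comp G)) fun x => hsum (J (G x))

end UnconditionalSums

/-! ### Continuity of coordinate projections. -/

section UnconditionalSumOfSubspaces

variable {E Γ : Type*} [NormedAddCommGroup E] [NormedSpace ℝ E] {F : Γ → Submodule ℝ E}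

/-- The coordinates in an unconditional sum of subspaces depend linearly on the vector. -/
theorem IsUnconditionalSumOfSubspaces.exists_linearMap (hF : IsUnconditionalSumOfSubspaces F) :
    ∃ y : (n : Γ) → E →ₗ[ℝ] F n, (∀ x, HasSum (fun n => (y n x : E)) x) ∧
      ∀ x (z : (n : Γ) → F n), HasSum (fun n => (z n : E)) x → ∀ n, y n x = z n := by
  choose y hy huniq using hF.existsUnique
  refine ⟨fun n => ⟨⟨fun x => y x n, fun x x' => ?_⟩, fun a x => ?_⟩, hy, fun x z hz n => ?_⟩
  · exact congrFun (huniq (x + x') (fun n => y x n + y x' n) ((hy x).add (hy x'))).symm n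
  · exact congrFun (huniq (a • x) (fun n => a • y x n) ((hy x).const_smul a)).symm n
  · exact congrFun (huniq x z hz).symm n

/-- The coordinate projections of an unconditional sum of subspaces are continuous. -/
theorem IsUnconditionalSumOfSubspaces.exists_continuousLinearMap [CompleteSpace E]
    (hF : IsUnconditionalSumOfSubspaces F) :
    ∃ P : (n : Γ) → E →L[ℝ] F n, ∀ x, HasSum (fun n => (P n x : E)) x := by
  classical
  obtain ⟨y, hy, huniq⟩ := hF.exists_linearMap
  have hmem (x : E) : Memℓp (fun A : Finset Γ => ∑ n ∈ A, (y n x : E)) ⊤ := by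
    obtain ⟨C, hC⟩ := (hy x).exists_norm_sum_le
    exact memℓp_infty ⟨C, by rintro _ ⟨A, rfl⟩; exact hC A⟩
  -- All finite partial sums are recorded at once, so that convergence in `lp` is uniform over
  -- finite sets and the closed graph theorem applies.
  let U : E →ₗ[ℝ] lp (fun _ : Finset Γ => E) ⊤ :=
    { toFun := fun x => ⟨fun A => ∑ n ∈ A, (y n x : E), hmem x⟩
      map_add' := fun x x' => by
        ext A
        simp [Finset.sum_add_distrib]
        rfl
      map_smul' := fun a x => by
        ext A
        simp [Finset.smul_sum] }
  have hU (x : E) (A : Finset Γ) : U x A = ∑ n ∈ A, (y n x : E) := rfl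
  have hcont : Continuous U := by
    refine U.continuous_of_seq_closed_graph fun u x z hu hUu => ?_
    have hunif : TendstoUniformly (fun j (A : Finset Γ) => U (u j) A) (fun A => z A) atTop := by
      rw [Metric.tendstoUniformly_iff]
      intro ε hε
      filter_upwards [Metric.tendsto_nhds.1 hUu ε hε] with j hj A
      rw [dist_comm, dist_eq_norm] at *
      exact (lp.norm_apply_le_norm ENNReal.top_ne_zero (U (u j) - z) A).trans_lt
        (by rwa [← norm_sub_rev])
    have hpt (A : Finset Γ) : Tendsto (fun j => U (u j) A) atTop (𝓝 (z A)) := hunif.tendsto_at A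
    have hzsum (A : Finset Γ) : z A = ∑ n ∈ A, z {n} := by
      refine tendsto_nhds_unique (hpt A) ?_
      have : (fun j => U (u j) A) = fun j => ∑ n ∈ A, U (u j) {n} := by
        ext j
        simp [hU]
      rw [this]
      exact tendsto_finsetSum _ fun n _ => hpt {n}
    have hzF (n : Γ) : z {n} ∈ F n := by
      refine (hF.isClosed n).mem_of_tendsto (hpt {n}) (Eventually.of_forall fun j => ?_)
      simp [hU]
    -- Uniformity permits interchanging the limit in `j` with the limit over finite sets; uniqueness
    -- then identifies `z` with `U x`.
    have hzx : HasSum (fun n => ((⟨z {n}, hzF n⟩ : F n) : E)) x := by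
      rw [HasSum, SummationFilter.unconditional_filter]
      simp only [← hzsum]
      refine hunif.tendsto_of_eventually_tendsto (Eventually.of_forall fun j => ?_) hu
      have := hy (u j)
      rwa [HasSum, SummationFilter.unconditional_filter] at this
    ext A
    rw [hzsum, hU]
    exact Finset.sum_congr rfl fun n _ => by rw [huniq x _ hzx n]
  let U' : E →L[ℝ] lp (fun _ : Finset Γ => E) ⊤ := ⟨U, hcont⟩
  refine ⟨fun n => (y n).mkContinuous ‖U'‖ fun x => ?_, hy⟩
  have h1 : ‖y n x‖ = ‖U x {n}‖ := by simp [hU]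
  rw [h1]
  exact (lp.norm_apply_le_norm ENNReal.top_ne_zero (U x) {n}).trans (U'.le_opNorm x)

end UnconditionalSumOfSubspaces

/-! ### The three cases of the theorem. -/

theorem mainTheorem2 {X Y E Γ : Type*}
    [NormedAddCommGroup X] [NormedSpace ℝ X] [CompleteSpace X]
    [NormedAddCommGroup Y] [NormedSpace ℝ Y] [CompleteSpace Y]
    [NormedAddCommGroup E] [NormedSpace ℝ E] [CompleteSpace E]
    (G : X →L[ℝ] Y) (hG : IsDaugavetCenter G) (hG0 : G ≠ 0) :
    ((∃ T : Γ → E →L[ℝ] E, (∀ n, IsWeaklyCompactOperator (T n)) ∧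
        IsPointwiseUnconditionalSum T (ContinuousLinearMap.id ℝ E)) →
      ¬ EmbedsInto X E ∧ ¬ EmbedsInto Y E) ∧
    (Nonempty (UnconditionalSchauderBasis Γ ℝ E) →
      ¬ EmbedsInto X E ∧ ¬ EmbedsInto Y E) ∧
    ((∃ F : Γ → Submodule ℝ E, (∀ n, IsReflexiveNormedSpace (F n)) ∧
        IsUnconditionalSumOfSubspaces F) →
      ¬ EmbedsInto X E ∧ ¬ EmbedsInto Y E) := by
  refine ⟨?_, ?_, ?_⟩
  · rintro ⟨T, hT, hsum⟩
    exact hG.not_embedsInto hG0 hT hsum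
  · rintro ⟨b⟩
    exact hG.not_embedsInto hG0 (T := fun n => (b.coord n).smulRight (b.basis n))
      (fun n => isWeaklyCompactOperator_smulRight _ _) b.expansion
  · rintro ⟨F, hrefl, hF⟩
    obtain ⟨P, hP⟩ := hF.exists_continuousLinearMap
    exact hG.not_embedsInto hG0 (T := fun n => (F n).subtypeL.comp (P n))
      (fun n => (hrefl n).isWeaklyCompactOperator_comp _ _) hP
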